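/- For functions $f,g$ from $\omega$ to the ordinals and $n\in\omega$, write $f<_n g$ if $f(m)<g(m)$ for all $m\in\omega$ with $m\ge n$, and $f<^*g$ if $\{m\in\omega : \neg(f(m)<g(m))\}$ is finite. Given ordinals $\eta$ and $\gamma$, a sequence $\langle f_\alpha : \alpha<\gamma\rangle$ of functions from $\omega$ to $\eta$ is \emph{strongly increasing} if (1) $f_\alpha<^*f_\beta$ for all $\alpha<\beta<\gamma$, and (2) for each limit ordinal $\beta<\gamma$ there exist a club (closed unbounded set) $C_\beta\subseteq\beta$ and an $n_\beta<\omega$ such that $f_\alpha<_{n_\beta}f_\beta$ for all $\alpha\in C_\beta$. \textbf{Theorem.} Suppose that $\lambda$ is an uncountable regular cardinal and that $\epsilon<\lambda^{+3}$ is an ordinal, where $\lambda^{+3}$ is the third cardinal successor of $\lambda$. Then there is no strongly increasing sequence $\langle f_\alpha : \alpha<\lambda^{+3}\rangle$ of functions from $\omega$ to $\epsilon$. -/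

import Mathlib

universe u

/-- `f <ₙ g`: `f m < g m` for all `m ∈ ω \ n`. -/
def LTFrom (n : ℕ) (f g : ℕ → Ordinal.{u}) : Prop :=
  ∀ m : ℕ, n ≤ m → f m < g m

/-- `f <* g`: the set of `n` at which `f n < g n` fails is finite. -/
def LTStar (f g : ℕ → Ordinal.{u}) : Prop :=
  {n : ℕ | ¬ f n < g n}.Finite

/-- `⟨f α : α < γ⟩` is a strongly increasing sequence of functions from `ω` to `η`.
Only the values `f α` with `α < γ` matter. Clubs in `β` are clubs, in the sense of `IsClub`,
of the well-order `Set.Iio β` of all ordinals below `β`. -/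
structure IsStronglyIncreasing (η γ : Ordinal.{u}) (f : Ordinal.{u} → ℕ → Ordinal.{u}) :
    Prop where
  lt_bound : ∀ α < γ, ∀ n : ℕ, f α n < η
  ltStar : ∀ α β : Ordinal.{u}, α < β → β < γ → LTStar (f α) (f β)
  exists_club : ∀ β < γ, Order.IsSuccLimit β →
    ∃ (C : Set (Set.Iio β)) (n : ℕ), IsClub C ∧ ∀ α ∈ C, LTFrom n (f α) (f β)

/-!
The argument is Shelah's: club guessing yields a projection property for the sequence, and the
projection property bounds the cofinalities occurring in minimal upper bounds.

Write `κ` for the uncountable regular cardinal, `θ = κ⁺⁺⁺`, and let `⟨f α : α < θ⟩` be strongly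
increasing and bounded by `ε < θ`. For sets of ordinals `S n` with `ε ∈ S n`, let `projUp S g n` be
the least element of `S n` above `g n`.

* `exists_club_guessing`: `κ⁺⁺` carries a family of `κ⁺⁺` many sets such that each club of `κ⁺⁺`
  includes a member of size at least `κ`.
* `bounding_projection`: if all `S n` have size less than `κ`, then some `projUp S (f β)` is an upper
  bound, modulo finite sets, of the whole sequence. Otherwise a normal function `δ : κ⁺⁺ → θ` is
  built together with indices `y i ≥ δ i` that anticipate upper bounds for the pieces
  `⟨f (δ j) : j ∈ c, j ≤ i⟩` with `c` in the guessing family (`exists_normal_tower`).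
  The club attached to `sup δ` makes one such `c` of size `κ` coherent: after thinning out, the
  functions `f (y i)`, `i ∈ c`, increase from a fixed `n` on, and a further thinning out makes
  `projUp S (f (y i)) m` strictly increasing at a fixed `m`, against the size of `S m`.
* `exists_smaller_bound`: every upper bound `h ≤ ε` can be lowered at infinitely many places. Where
  `h n` has cofinality less than `κ`, this is the projection to small cofinal subsets of `h n`.
  Otherwise the cofinality is `κ`, `κ⁺` or `κ⁺⁺`, so it takes one value `μ < θ` infinitely often, and
  pigeonhole over `μ` yields a single level of fundamental sequences that bounds cofinally many `f α`.

Lowering bounds `ω₁` times, each time starting from the projection to the set of the earlier values,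
leads to a contradiction: for one large `ξ`, the projections of `f ξ` to these growing sets decrease
along `ω₁` at every `n`, hence are eventually constant, simultaneously for all `n`, whereas each
lowering step changes one of them.
-/

open Cardinal Order Set Filter

universe v

/-! ### Well-founded recursion and stabilization -/

/-- Transfinite recursion with a relation: if the requirement `R j h x` on the value `x` at `j` depends
only on the values of `h` below `j` and can always be met, then some `h` meets it everywhere. -/
theorem exists_wellFounded_recursion {J X : Type*} [LinearOrder J] [WellFoundedLT J] [Inhabited X]
    (R : J → (J → X) → X → Prop) (hex : ∀ j g, ∃ x, R j g x)
    (hcongr : ∀ j g g' x, (∀ k < j, g k = g' k) → R j g x → R j g' x) :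
    ∃ h : J → X, ∀ j, R j h (h j) := by
  classical
  choose F hF using hex
  let h : J → X := (wellFounded_lt (α := J)).fix
    fun j g ↦ F j fun k ↦ if hk : k < j then g k hk else default
  refine ⟨h, fun j ↦ ?_⟩
  have hj : h j = F j fun k ↦ if k < j then h k else default := by
    simp only [h]
    rw [WellFounded.fix_eq]
    simp
  rw [hj]
  exact hcongr j _ _ _ (fun k hk ↦ if_pos hk) (hF j _)

theorem exists_forall_ge_eq_of_antitone {J Y : Type*} [LinearOrder J] [Nonempty J]
    [LinearOrder Y] [WellFoundedLT Y] {g : J → Y} (hg : Antitone g) :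
    ∃ i, ∀ j, i ≤ j → g j = g i := by
  obtain ⟨y, ⟨i, rfl⟩, hi⟩ := wellFounded_lt.has_min (range g) (range_nonempty g)
  exact ⟨i, fun j hj ↦ (hg hj).antisymm (not_lt.1 (hi _ ⟨j, rfl⟩))⟩

theorem exists_forall_le_of_lt_cof {J X : Type u} [LinearOrder J] (hX : #X < cof J) (i : X → J) :
    ∃ b, ∀ x, i x ≤ b := by
  have : BddAbove (range i) := .of_not_isCofinal fun h ↦
    ((cof_le h).trans mk_range_le).not_gt hX
  obtain ⟨b, hb⟩ := this
  exact ⟨b, fun x ↦ hb ⟨x, rfl⟩⟩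

/-- Fewer than `cof J` antitone functions from `J` to a well-order are constant from a common index on. -/
theorem exists_forall_ge_eq_of_antitone_family {J X : Type u} {Y : Type*} [LinearOrder J]
    [LinearOrder Y] [WellFoundedLT Y] (hX : #X < cof J) {g : X → J → Y}
    (hg : ∀ x, Antitone (g x)) : ∃ i, ∀ x j, i ≤ j → g x j = g x i := by
  have : Nonempty J := cof_ne_zero_iff.1 (bot_le.trans_lt hX).ne'
  choose i hi using fun x ↦ exists_forall_ge_eq_of_antitone (hg x)
  obtain ⟨b, hb⟩ := exists_forall_le_of_lt_cof hX i
  exact ⟨b, fun x j hj ↦ (hi x j ((hb x).trans hj)).trans (hi x b (hb x)).symm⟩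

/-! ### Club guessing -/

theorem IsClub.preimage_of_isNormal {I : Type u} {Y : Type v} [LinearOrder I] [WellFoundedLT I]
    [LinearOrder Y] [WellFoundedLT Y] (hI : cof I ≠ ℵ₀) {δ : I → Y} (hδ : IsNormal δ)
    (hcof : IsCofinal (range δ)) {C : Set Y} (hC : IsClub C) : IsClub (δ ⁻¹' C) := by
  have hY : cof Y ≠ ℵ₀ := by
    intro h
    have := lift_cof_congr_of_strictMono hδ.strictMono hcof
    rw [h, lift_aleph0, lift_eq_aleph0] at this
    exact hI this
  have hrange : IsClub (range δ) := by
    refine ⟨fun s hs hs₀ _ y hy ↦ ?_, hcof⟩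
    have hs' : (δ ⁻¹' s).Nonempty := by
      obtain ⟨z, hz⟩ := hs₀
      obtain ⟨i, rfl⟩ := hs hz
      exact ⟨i, hz⟩
    obtain ⟨_, ⟨b, rfl⟩, hb⟩ := hcof y
    have : Nonempty I := ⟨b⟩
    let := WellFoundedLT.toOrderBot I
    let := WellFoundedLT.conditionallyCompleteLinearOrderBot I
    have hlub : IsLUB (δ ⁻¹' s) (sSup (δ ⁻¹' s)) :=
      isLUB_csSup hs' ⟨b, fun i hi ↦ hδ.strictMono.le_iff_le.1 ((hy.1 hi).trans hb)⟩
    have := hδ.map_isLUB hlub hs'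
    rw [image_preimage_eq_of_subset hs] at this
    exact ⟨_, this.unique hy⟩
  refine ⟨fun s hs hs₀ _ i hi ↦ ?_, fun i ↦ ?_⟩
  · exact hC.isLUB_mem (image_subset_iff.2 hs) (hs₀.image δ) (hδ.map_isLUB hi hs₀)
  · obtain ⟨_, ⟨hjC, j, rfl⟩, hj⟩ := (hC.inter hY hrange).isCofinal (δ i)
    exact ⟨j, hjC, hδ.strictMono.le_iff_le.1 hj⟩

/-- A cofinal set has limit points of every regular cofinality `κ` below the cofinality of the order:
the supremum of the first `κ` many of its elements is one. -/
theorem exists_cof_Iio_eq {I : Type u} [LinearOrder I] [WellFoundedLT I] {κ : Cardinal.{u}}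
    (hκ : κ.IsRegular) (hI : κ < cof I) {E : Set I} (hE : IsCofinal E) :
    ∃ a, cof (Iio a) = κ ∧ ∀ b < a, ∃ e ∈ E, b < e ∧ e < a := by
  have htype : Ordinal.type (α := κ.ord.ToType) (· < ·) ≤ Ordinal.type (α := E) (· < ·) := by
    rw [Ordinal.type_toType, ord_le, Ordinal.card_type]
    exact hI.le.trans (cof_le hE)
  obtain ⟨g⟩ := Ordinal.type_le_iff'.1 htype
  have hg : StrictMono fun i ↦ (g i : I) := fun i j h ↦ g.map_rel_iff.2 h
  obtain ⟨b, hb⟩ := exists_forall_le_of_lt_cof (by simpa using hI) fun i ↦ (g i : I)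
  have : Nonempty I := ⟨b⟩
  have hκcof : cof κ.ord.ToType = κ := by rw [Ordinal.cof_toType, hκ.cof_ord]
  have : Nonempty κ.ord.ToType := by
    rw [← cof_ne_zero_iff, hκcof]; exact hκ.pos.ne'
  have : NoMaxOrder κ.ord.ToType := by
    rw [← noTopOrder_iff_noMaxOrder, ← one_lt_cof_iff, hκcof]
    exact one_lt_aleph0.trans_le hκ.aleph0_le
  let := WellFoundedLT.toOrderBot I
  let := WellFoundedLT.conditionallyCompleteLinearOrderBot I
  have hbdd : BddAbove (range fun i ↦ (g i : I)) := ⟨b, by rintro _ ⟨i, rfl⟩; exact hb i⟩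
  have hlt (i) : (g i : I) < ⨆ i, (g i : I) := by
    obtain ⟨j, hj⟩ := exists_gt i
    exact (hg hj).trans_le (le_ciSup hbdd j)
  refine ⟨⨆ i, (g i : I), ?_, fun c hc ↦ ?_⟩
  · refine Eq.trans (Eq.symm ?_) hκcof
    refine cof_congr_of_strictMono (f := fun i ↦ (⟨g i, hlt i⟩ : Iio (⨆ i, (g i : I))))
      (fun i j h ↦ hg h) fun c ↦ ?_
    obtain ⟨i, hi⟩ := exists_lt_of_lt_ciSup c.2
    exact ⟨_, ⟨i, rfl⟩, hi.le⟩
  · obtain ⟨i, hi⟩ := exists_lt_of_lt_ciSup hc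
    exact ⟨g i, (g i).2, hi, hlt i⟩

/-- Club guessing, for guesses that need only be large subsets of the club. Cofinal subsets `A a` of the
initial segments are glued to a club `E` by replacing `x ∈ A a` with `sup (E ∩ Iic x)`; one of these
glued families guesses all clubs. -/
theorem exists_club_guessing {I : Type u} [LinearOrder I] [WellFoundedLT I] {κ : Cardinal.{u}}
    (hκ : κ.IsRegular) (hI : succ κ < cof I) :
    ∃ c : I → Set I, ∀ D, IsClub D → ∃ a, κ ≤ #(c a) ∧ c a ⊆ D := by
  have hκI : κ < cof I := (lt_succ κ).trans hI
  have hI₀ : cof I ≠ ℵ₀ := (hκ.aleph0_le.trans_lt hκI).ne'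
  have : Nonempty I := cof_ne_zero_iff.1 (bot_le.trans_lt hI).ne'
  let := WellFoundedLT.toOrderBot I
  let := WellFoundedLT.conditionallyCompleteLinearOrderBot I
  choose A hA hA' using fun a : I ↦ exists_cof_eq (Iio a)
  let drop (E : Set I) (x : I) : I := sSup (E ∩ Iic x)
  have hbdd (E : Set I) (x : I) : BddAbove (E ∩ Iic x) := bddAbove_Iic.mono inter_subset_right
  have hdrop {E : Set I} (hE : IsClub E) {x : I} (hx : drop E x ≠ ⊥) : drop E x ∈ E := by
    refine hE.csSup_mem inter_subset_left ?_ (hbdd E x)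
    rw [nonempty_iff_ne_empty]
    intro h
    exact hx (by simp [drop, h])
  -- `⊥` is left out, since it is the junk value of `drop E x` when `E ∩ Iic x` is empty.
  let c (E : Set I) (a : I) : Set I := {z | z ≠ ⊥ ∧ ∃ x ∈ A a, drop E x = z}
  suffices ∃ E, ∀ D, IsClub D → ∃ a, κ ≤ #(c E a) ∧ c E a ⊆ D from
    let ⟨E, hE⟩ := this; ⟨c E, hE⟩
  by_contra! hbad
  choose D hD hcD using hbad
  -- If every `c E` misses some club `D E`, these clubs are intersected `κ⁺` times. At a point `a` of
  -- cofinality `κ`, the `κ` many functions `j ↦ drop (E j) x` stabilize before `κ⁺`.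
  let J := (succ κ).ord.ToType
  have hJcof : cof J = succ κ := by
    rw [Ordinal.cof_toType, (isRegular_succ hκ.aleph0_le).cof_ord]
  obtain ⟨E, hE⟩ := exists_wellFounded_recursion (J := J) (X := Set I)
    (fun j g x ↦ x = ⋂ k : Iio j, g k ∩ D (g k)) (fun j g ↦ ⟨_, rfl⟩) (by
      rintro j g g' x h rfl
      exact iInter_congr fun k ↦ by rw [h k k.2])
  have hEclub (j : J) : IsClub (E j) := by
    induction j using WellFoundedLT.induction with | ind j ih
    rw [hE j]
    refine IsClub.iInter hI₀ ?_ fun k ↦ (ih k k.2).inter hI₀ (hD _)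
    exact Cardinal.lift_lt.2 ((mk_Iio_lt j (by simp [J])).trans ((mk_ord_toType _).trans_lt hI))
  have hElt {j k : J} (h : k < j) : E j ⊆ E k ∩ D (E k) := by
    rw [hE j]; exact iInter_subset (fun k : Iio j ↦ E k ∩ D (E k)) ⟨k, h⟩
  have hEanti : Antitone E := antitone_iff_forall_lt.2 fun k j h ↦
    (hElt h).trans inter_subset_left
  have hEI : IsClub (⋂ j, E j) := IsClub.iInter hI₀ (by simpa [J] using hI) hEclub
  obtain ⟨a, ha, haE⟩ := exists_cof_Iio_eq hκ hκI hEI.isCofinal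
  obtain ⟨i, hi⟩ := exists_forall_ge_eq_of_antitone_family (J := J) (X := A a)
    (g := fun x j ↦ drop (E j) x) (by rw [hA', ha, hJcof]; exact lt_succ κ) fun x j k hjk ↦
      csSup_le_csSup' (hbdd _ _) (inter_subset_inter_left _ (hEanti hjk))
  have : NoMaxOrder J := by
    have : Nonempty J := ⟨i⟩
    rw [← noTopOrder_iff_noMaxOrder, ← one_lt_cof_iff, hJcof]
    exact (one_lt_aleph0.trans_le hκ.aleph0_le).trans (lt_succ κ)
  obtain ⟨j, hij⟩ := exists_gt i
  refine hcD (E i) a ?_ ?_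
  · have hcof : IsCofinal {z : Iio a | (z : I) ∈ c (E i) a} := by
      intro b
      obtain ⟨e, he, hbe, hea⟩ := haE b b.2
      obtain ⟨x, hx, hex⟩ := hA a ⟨e, hea⟩
      have hez : e ≤ drop (E i) x := le_csSup (hbdd _ _) ⟨mem_iInter.1 he i, hex⟩
      refine ⟨⟨drop (E i) x, ?_⟩, ⟨?_, x, ?_⟩, ?_⟩
      · exact (csSup_le' fun z hz ↦ hz.2 : drop (E i) x ≤ x).trans_lt x.2
      · exact (bot_le.trans_lt (hbe.trans_le hez)).ne'
      · exact ⟨hx, rfl⟩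
      · exact hbe.le.trans hez
    calc κ = cof (Iio a) := ha.symm
      _ ≤ _ := cof_le hcof
      _ ≤ #(c (E i) a) := mk_preimage_of_injective _ _ Subtype.val_injective
  · rintro _ ⟨hz, x, hx, rfl⟩
    have heq := hi ⟨x, hx⟩ j hij.le
    simp only at heq
    rw [← heq] at hz ⊢
    exact (hElt hij (hdrop (hEclub j) hz)).2

/-! ### The bounding projection property -/

/-- A normal function `δ` into `θ` together with ordinals `y i ≥ δ i` that realize, for every `a`, the
property `K a i δ` of ordinals whenever some ordinal below `θ` does. The property is upward closed and
depends on the values of `δ` up to `i` only; `δ j` also exceeds `N (y i)` for all `i < j`. -/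
theorem exists_normal_tower {θ : Ordinal.{u}} (hθ : IsSuccLimit θ) {I : Type u} [LinearOrder I]
    [WellFoundedLT I] [NoMaxOrder I] (hI : #I < θ.cof) {N : Ordinal → Ordinal}
    (hN : ∀ x < θ, N x < θ) (hN' : ∀ x, x < N x)
    (K : I → I → (I → Ordinal) → Ordinal → Prop)
    (hcongr : ∀ a i d d' x, (∀ j ≤ i, d j = d' j) → K a i d x → K a i d' x)
    (hmono : ∀ a i d x x', x ≤ x' → x' < θ → K a i d x → K a i d x') :
    ∃ δ y : I → Ordinal.{u}, IsNormal δ ∧ (∀ i, δ i < θ) ∧ (∀ i, y i < θ) ∧ (∀ i, δ i ≤ y i) ∧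
      (∀ i j, i < j → N (y i) ≤ δ j) ∧ ∀ a i, (∃ x < θ, K a i δ x) → K a i δ (y i) := by
  let d (y : I → Ordinal.{u}) (j : I) : Ordinal.{u} := ⨆ k : Iio j, N (y k)
  have hd {y y' : I → Ordinal.{u}} {j : I} (h : ∀ k < j, y k = y' k) : d y j = d y' j :=
    iSup_congr fun k ↦ by rw [h k k.2]
  have hdlt {y : I → Ordinal.{u}} {j : I} (h : ∀ k < j, y k < θ) : d y j < θ :=
    Ordinal.iSup_lt_of_lt_cof ((mk_set_le _).trans_lt hI) fun k ↦ hN _ (h k k.2)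
  obtain ⟨y, hy⟩ := exists_wellFounded_recursion (J := I) (X := Ordinal.{u})
    (fun i y x ↦ (∀ k < i, y k < θ) →
      d y i ≤ x ∧ x < θ ∧ ∀ a, (∃ x' < θ, K a i (d y) x') → K a i (d y) x) (by
    intro i y
    by_cases hy : ∀ k < i, y k < θ
    · have hpt (a : I) : ∃ x < θ, (∃ x' < θ, K a i (d y) x') → K a i (d y) x := by
        by_cases h : ∃ x' < θ, K a i (d y) x'
        · obtain ⟨x, hx, hx'⟩ := h
          exact ⟨x, hx, fun _ ↦ hx'⟩
        · exact ⟨0, hθ.bot_lt, fun h' ↦ (h h').elim⟩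
      choose x hx hxK using hpt
      have hs : max (d y i) (⨆ a, x a) < θ :=
        max_lt (hdlt hy) (Ordinal.iSup_lt_of_lt_cof hI hx)
      exact ⟨max (d y i) (⨆ a, x a), fun _ ↦ ⟨le_max_left _ _, hs, fun a ha ↦
        hmono _ _ _ _ _ ((Ordinal.le_iSup x a).trans (le_max_right _ _)) hs (hxK a ha)⟩⟩
    · exact ⟨0, fun h ↦ (hy h).elim⟩) (by
    intro i y y' x h hx hy'
    have hdeq : ∀ j ≤ i, d y j = d y' j := fun j hj ↦ hd fun k hk ↦ h k (hk.trans_le hj)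
    obtain ⟨h₁, h₂, h₃⟩ := hx fun k hk ↦ (h k hk).trans_lt (hy' k hk)
    refine ⟨(hdeq i le_rfl).symm.trans_le h₁, h₂, fun a ⟨x', hx', hK⟩ ↦ ?_⟩
    exact hcongr _ _ _ _ _ hdeq
      (h₃ a ⟨x', hx', hcongr _ _ _ _ _ (fun j hj ↦ (hdeq j hj).symm) hK⟩))
  have hyθ (i : I) : y i < θ := by
    induction i using WellFoundedLT.induction with | ind i ih
    exact (hy i ih).2.1
  have hle (i j : I) (h : i < j) : N (y i) ≤ d y j :=
    Ordinal.le_iSup (fun k : Iio j ↦ N (y k)) ⟨i, h⟩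
  have hdy (i : I) : d y i ≤ y i := (hy i fun k _ ↦ hyθ k).1
  refine ⟨d y, y, isNormal_iff.2 ⟨fun i j h ↦ ?_, fun i hi x hx ↦ ?_⟩, fun i ↦ hdlt fun k _ ↦ hyθ k,
    hyθ, hdy, hle, fun a i ↦ (hy i fun k _ ↦ hyθ k).2.2 a⟩
  · exact ((hdy i).trans_lt (hN' _)).trans_le (hle i j h)
  · refine Ordinal.iSup_le fun k ↦ ?_
    obtain ⟨j, hkj, hji⟩ := hi.isSuccPrelimit.lt_iff_exists_lt.1 k.2
    exact (hle k j hji).trans (hx j hkj)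

theorem LTStar.eventually_lt {f g : ℕ → Ordinal.{u}} (h : LTStar f g) :
    ∀ᶠ n in atTop, f n < g n := by
  rw [← Nat.cofinite_eq_atTop]
  exact h

namespace IsStronglyIncreasing
variable {ε θ : Ordinal.{u}} {f : Ordinal.{u} → ℕ → Ordinal.{u}}

theorem eventually_le (hf : IsStronglyIncreasing ε θ f) {α β : Ordinal.{u}} (h : α ≤ β)
    (hβ : β < θ) : ∀ᶠ n in atTop, f α n ≤ f β n := by
  obtain rfl | h := h.eq_or_lt
  · exact .of_forall fun _ ↦ le_rfl
  · exact (hf.ltStar α β h hβ).eventually_lt.mono fun _ ↦ le_of_lt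

end IsStronglyIncreasing

/-- `projUp S g n` is the least element of `S n` that is at least `g n`, and the junk value `0` if there
is none. -/
noncomputable def projUp (S : ℕ → Set Ordinal.{u}) (g : ℕ → Ordinal.{u}) (n : ℕ) : Ordinal.{u} :=
  sInf {s ∈ S n | g n ≤ s}

section projUp
variable {S T : ℕ → Set Ordinal.{u}} {g h : ℕ → Ordinal.{u}} {n : ℕ} {s : Ordinal.{u}}

theorem projUp_le (hs : s ∈ S n) (hg : g n ≤ s) : projUp S g n ≤ s :=
  csInf_le' ⟨hs, hg⟩

theorem projUp_mem (h : ∃ s ∈ S n, g n ≤ s) : projUp S g n ∈ S n :=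
  (csInf_mem (s := {s ∈ S n | g n ≤ s}) h).1

theorem le_projUp (h : ∃ s ∈ S n, g n ≤ s) : g n ≤ projUp S g n :=
  (csInf_mem (s := {s ∈ S n | g n ≤ s}) h).2

/-- The projection is monotone in the function and antitone in the sets. -/
theorem projUp_mono (hS : S n ⊆ T n) (hgh : g n ≤ h n) (hh : ∃ s ∈ S n, h n ≤ s) :
    projUp T g n ≤ projUp S h n :=
  projUp_le (hS (projUp_mem hh)) (hgh.trans (le_projUp hh))

end projUp

/-- Pigeonhole for countable colourings of a set of uncountable regular size. -/
theorem exists_subset_const {I : Type u} {κ : Cardinal.{u}} (hκ : κ.IsRegular) (hunc : ℵ₀ < κ)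
    {c : Set I} (hc : κ ≤ #c) (n : I → ℕ) : ∃ m, ∃ c' ⊆ c, κ ≤ #c' ∧ ∀ i ∈ c', n i = m := by
  obtain ⟨m, t, ht, hκt, h⟩ := infinite_pigeonhole_set (fun i : c ↦ ULift.up.{u} (n i)) κ hc
    hκ.aleph0_le (by rw [hκ.cof_ord]; simpa using hunc)
  exact ⟨m.down, t, ht, hκt, fun i hi ↦ congrArg ULift.down (h hi)⟩

theorem exists_isLeast_gt {I : Type*} [LinearOrder I] [WellFoundedLT I] {c : Set I} {i j : I}
    (hj : j ∈ c) (hij : i < j) : ∃ k, IsLeast {k ∈ c | i < k} k ∧ k ≤ j := by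
  obtain ⟨k, hk, hk'⟩ := wellFounded_lt.has_min {k ∈ c | i < k} ⟨j, hj, hij⟩
  exact ⟨k, ⟨hk, fun x hx ↦ not_lt.1 (hk' x hx)⟩, not_lt.1 (hk' j ⟨hj, hij⟩)⟩

/-- The bounding projection property: for sets `S n` of size less than `κ` that contain the common bound
`ε`, the projection of a single `f β` is an upper bound of all `f α` modulo finite sets. -/
theorem bounding_projection {κ : Cardinal.{u}} (hκ : κ.IsRegular) (hunc : ℵ₀ < κ)
    {ε : Ordinal.{u}} {f : Ordinal.{u} → ℕ → Ordinal.{u}}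
    (hf : IsStronglyIncreasing ε (succ (succ (succ κ))).ord f) {S : ℕ → Set Ordinal.{u}}
    (hS : ∀ n, #(S n) < Cardinal.lift.{u + 1} κ) (hε : ∀ n, ε ∈ S n) :
    ∃ β < (succ (succ (succ κ))).ord, ∀ α < (succ (succ (succ κ))).ord,
      ∀ᶠ n in atTop, f α n ≤ projUp S (f β) n := by
  set θ := (succ (succ (succ κ))).ord with hθdef
  have hreg₂ : (succ (succ κ)).IsRegular := isRegular_succ (hκ.aleph0_le.trans (lt_succ κ).le)
  have hreg₃ : (succ (succ (succ κ))).IsRegular := isRegular_succ hreg₂.aleph0_le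
  have hθ : IsSuccLimit θ := isSuccLimit_ord hreg₃.aleph0_le
  have hθcof : θ.cof = succ (succ (succ κ)) := hreg₃.cof_ord
  have hex {α : Ordinal.{u}} (hα : α < θ) (n : ℕ) : ∃ s ∈ S n, f α n ≤ s :=
    ⟨ε, hε n, (hf.lt_bound α hα n).le⟩
  by_contra! hbad
  -- `ν β` indexes a function that is not eventually bounded by the projection of `f β`.
  choose! ν hν hνf using hbad
  let I := (succ (succ κ)).ord.ToType
  have hIcof : cof I = succ (succ κ) := by rw [Ordinal.cof_toType, hreg₂.cof_ord]
  have hI₀ : ℵ₀ < cof I := by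
    rw [hIcof]; exact hunc.trans ((lt_succ _).trans (lt_succ _))
  have : Nonempty I := cof_ne_zero_iff.1 (bot_le.trans_lt hI₀).ne'
  have : NoMaxOrder I := by
    rw [← noTopOrder_iff_noMaxOrder, ← one_lt_cof_iff]
    exact one_lt_aleph0.trans hI₀
  obtain ⟨c, hc⟩ := exists_club_guessing (I := I) hκ ((lt_succ _).trans_eq hIcof.symm)
  obtain ⟨δ, y, hδ, hδθ, hyθ, hδy, hyδ, hK⟩ := exists_normal_tower hθ (I := I)
    (by rw [hθcof, mk_ord_toType]; exact lt_succ _)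
    (N := fun x ↦ succ (max x (ν x))) (fun x hx ↦ hθ.succ_lt (max_lt hx (hν x hx)))
    (fun x ↦ lt_succ_of_le (le_max_left _ _))
    (fun a i d x ↦ ∀ᶠ n in atTop, ∀ j ∈ c a, j ≤ i → f (d j) n ≤ f x n)
    (fun a i d d' x h hx ↦ hx.mono fun n hn j hj hji ↦ h j hji ▸ hn j hj hji)
    (fun a i d x x' hxx' hx' hx ↦ by
      filter_upwards [hx, hf.eventually_le hxx' hx'] with n hn hn' j hj hji
      exact (hn j hj hji).trans hn')
  have hβθ : ⨆ i, δ i < θ :=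
    Ordinal.iSup_lt_of_lt_cof (by rw [hθcof, mk_ord_toType]; exact lt_succ _) hδθ
  have hδβ (i : I) : δ i < ⨆ i, δ i := by
    obtain ⟨j, hj⟩ := exists_gt i
    exact (hδ.strictMono hj).trans_le (Ordinal.le_iSup δ j)
  have hβ : IsSuccLimit (⨆ i, δ i) := by
    rw [← Ordinal.one_lt_cof_iff, Ordinal.cof_iSup hδ.strictMono]
    exact one_lt_aleph0.trans hI₀
  obtain ⟨C, n₀, hC, hCf⟩ := hf.exists_club _ hβθ hβ
  let δ' (i : I) : Iio (⨆ i, δ i) := ⟨δ i, hδβ i⟩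
  have hδ' : IsNormal δ' :=
    isNormal_iff.2 ⟨fun i j h ↦ hδ.strictMono h, fun i hi x hx ↦ (isNormal_iff.1 hδ).2 i hi x hx⟩
  obtain ⟨a, ha, haC⟩ := hc _ (hC.preimage_of_isNormal hI₀.ne' hδ' fun x ↦ by
    obtain ⟨i, hi⟩ := Ordinal.lt_iSup_iff.1 x.2
    exact ⟨_, ⟨i, rfl⟩, hi.le⟩)
  -- `f (sup δ)` bounds all `f (δ j)`, `j ∈ c a`, from `n₀` on, so `y i` was chosen as a bound as well.
  have hy (i : I) : ∀ᶠ n in atTop, ∀ j ∈ c a, j ≤ i → f (δ j) n ≤ f (y i) n := by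
    refine hK a i ⟨_, hβθ, (eventually_ge_atTop n₀).mono fun n hn j hj _ ↦ ?_⟩
    exact (hCf (δ' j) (haC hj) n hn).le
  have hyδ' {i j : I} (hij : i < j) : y i ≤ δ j ∧ ν (y i) ≤ y j := by
    have := (le_succ _).trans (hyδ i j hij)
    exact ⟨(le_max_left _ _).trans this, ((le_max_right _ _).trans this).trans (hδy j)⟩
  -- Beyond `n i`, the function `f (y i)` lies above `f (δ j)` for `j ∈ c a` up to `i`, and below `f (δ k)`
  -- for the next element `k` of `c a`; this compares `f (y i)` with `f (y j)` beyond the maximum of `n i` and `n j`.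
  have hn (i : I) : ∃ n, ∀ m, n ≤ m → (∀ j ∈ c a, j ≤ i → f (δ j) m ≤ f (y i) m) ∧
      ∀ k, IsLeast {k ∈ c a | i < k} k → f (y i) m ≤ f (δ k) m := by
    rw [← eventually_atTop]
    refine (hy i).and ?_
    by_cases h : ∃ k, IsLeast {k ∈ c a | i < k} k
    · obtain ⟨k, hk⟩ := h
      filter_upwards [hf.eventually_le (hyδ' hk.1.2).1 (hδθ k)] with m hm k' hk'
      rwa [hk'.unique hk]
    · exact .of_forall fun m k hk ↦ (h ⟨k, hk⟩).elim
  choose n hn using hn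
  obtain ⟨n₁, c₁, hc₁, hκ₁, hnc₁⟩ := exists_subset_const hκ hunc ha n
  have hymono {i j : I} (hi : i ∈ c₁) (hj : j ∈ c₁) (hij : i ≤ j) {m : ℕ} (hm : n₁ ≤ m) :
      f (y i) m ≤ f (y j) m := by
    obtain rfl | hij := hij.eq_or_lt
    · rfl
    obtain ⟨k, hk, hkj⟩ := exists_isLeast_gt (hc₁ hj) hij
    exact ((hn i m ((hnc₁ i hi).trans_le hm)).2 k hk).trans
      ((hn j m ((hnc₁ j hj).trans_le hm)).1 k hk.1.1 hkj)
  -- At `m i`, the projection of `f (y i)` lies below `f (y k)`, where `k` is the next element of `c₁`.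
  have hm (i : I) : ∃ m, n₁ ≤ m ∧
      ∀ k, IsLeast {k ∈ c₁ | i < k} k → projUp S (f (y i)) m < f (y k) m := by
    by_cases h : ∃ k, IsLeast {k ∈ c₁ | i < k} k
    · obtain ⟨k, hk⟩ := h
      obtain ⟨m, ⟨hm, hm'⟩, hm''⟩ := (((hνf (y i) (hyθ i)).and_eventually
        (hf.eventually_le (hyδ' hk.1.2).2 (hyθ k))).and_eventually (eventually_ge_atTop n₁)).exists
      exact ⟨m, hm'', fun k' hk' ↦ by rw [hk'.unique hk]; exact hm.trans_le hm'⟩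
    · exact ⟨n₁, le_rfl, fun k hk ↦ (h ⟨k, hk⟩).elim⟩
  choose m hm hm' using hm
  obtain ⟨m₁, c₂, hc₂, hκ₂, hmc₂⟩ := exists_subset_const hκ hunc hκ₁ m
  have hlt {i j : I} (hi : i ∈ c₂) (hj : j ∈ c₂) (hij : i < j) :
      projUp S (f (y i)) m₁ < projUp S (f (y j)) m₁ := by
    obtain ⟨k, hk, hkj⟩ := exists_isLeast_gt (hc₂ hj) hij
    have hmi := hmc₂ i hi
    calc projUp S (f (y i)) m₁ < f (y k) m₁ := hmi ▸ hm' i k hk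
      _ ≤ f (y j) m₁ := hymono hk.1.1 (hc₂ hj) hkj (hmi ▸ hm i)
      _ ≤ _ := le_projUp (hex (hyθ j) _)
  have hinj : Function.Injective
      (fun i : c₂ ↦ (⟨projUp S (f (y i)) m₁, projUp_mem (hex (hyθ i) _)⟩ : S m₁)) :=
    StrictMono.injective fun i j hij ↦ hlt i.2 j.2 hij
  have := mk_le_of_injective (α := ULift.{u + 1} c₂) (hinj.comp ULift.down_injective)
  rw [mk_uLift] at this
  exact ((Cardinal.lift_le.2 hκ₂).trans this).not_gt (hS m₁)

/-! ### Lowering upper bounds -/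

/-- `h` is an upper bound of `⟨f α : α < θ⟩` modulo finite sets. -/
def IsEventualUpperBound (θ : Ordinal.{u}) (f : Ordinal.{u} → ℕ → Ordinal.{u})
    (h : ℕ → Ordinal.{u}) : Prop :=
  ∀ α < θ, ∀ᶠ n in atTop, f α n ≤ h n

theorem IsStronglyIncreasing.eventually_lt_of_isEventualUpperBound {ε θ : Ordinal.{u}}
    {f : Ordinal.{u} → ℕ → Ordinal.{u}} (hf : IsStronglyIncreasing ε θ f) (hθ : IsSuccLimit θ)
    {h : ℕ → Ordinal.{u}} (hh : IsEventualUpperBound θ f h) {α : Ordinal.{u}} (hα : α < θ) :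
    ∀ᶠ n in atTop, f α n < h n := by
  filter_upwards [(hf.ltStar α _ (lt_succ α) (hθ.succ_lt hα)).eventually_lt,
    hh _ (hθ.succ_lt hα)] with n h₁ h₂
  exact h₁.trans_le h₂

theorem exists_subset_Iio_isCofinal (o : Ordinal.{u}) : ∃ T ⊆ Iio o,
    #T ≤ Cardinal.lift.{u + 1} o.cof ∧ ∀ b < o, ∃ x ∈ T, b ≤ x := by
  obtain ⟨T, hT, hT'⟩ := exists_cof_eq (Iio o)
  refine ⟨Subtype.val '' T, by rintro _ ⟨x, -, rfl⟩; exact x.2, ?_, fun b hb ↦ ?_⟩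
  · refine mk_image_le.trans ?_
    rw [hT', Ordinal.cof_Iio, Ordinal.lift_cof]
  · obtain ⟨x, hx, hbx⟩ := hT ⟨b, hb⟩
    exact ⟨x, ⟨x, hx, rfl⟩, hbx⟩

/-- If `h n` has cofinality less than `κ` for infinitely many `n`, then the upper bound `h` is lowered by
projecting to small cofinal subsets of these `h n`. Successors `h n` are included, as cofinality `1`. -/
theorem exists_smaller_bound_of_cof_lt {κ : Cardinal.{u}} (hκ : κ.IsRegular) (hunc : ℵ₀ < κ)
    {ε : Ordinal.{u}} {f : Ordinal.{u} → ℕ → Ordinal.{u}}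
    (hf : IsStronglyIncreasing ε (succ (succ (succ κ))).ord f) {h : ℕ → Ordinal.{u}}
    (hh : IsEventualUpperBound (succ (succ (succ κ))).ord f h)
    (hcof : ∃ᶠ n in atTop, (h n).cof < κ) :
    ∃ h', IsEventualUpperBound (succ (succ (succ κ))).ord f h' ∧ (∀ n, h' n ≤ h n) ∧
      ∃ᶠ n in atTop, h' n < h n := by
  classical
  choose T hT hTcard hTcof using exists_subset_Iio_isCofinal.{u}
  have hθ : IsSuccLimit (succ (succ (succ κ))).ord := isSuccLimit_ord
    (hκ.aleph0_le.trans ((lt_succ _).trans ((lt_succ _).trans (lt_succ _))).le)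
  let S (n : ℕ) : Set Ordinal.{u} := insert ε (if (h n).cof < κ then T (h n) else ∅)
  obtain ⟨β, hβ, hβf⟩ := bounding_projection hκ hunc hf (S := S) (fun n ↦ by
    have hlift : ℵ₀ ≤ Cardinal.lift.{u + 1} κ := by simpa using hκ.aleph0_le
    refine (mk_insert_le).trans_lt (add_lt_of_lt hlift ?_ (one_lt_aleph0.trans_le hlift))
    split_ifs with hn
    · exact (hTcard _).trans_lt (Cardinal.lift_lt.2 hn)
    · simpa using hκ.pos) fun n ↦ mem_insert _ _
  refine ⟨fun n ↦ min (projUp S (f β) n) (h n), fun α hα ↦ ?_, fun n ↦ min_le_right _ _, ?_⟩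
  · filter_upwards [hβf α hα, hh α hα] with n h₁ h₂ using le_min h₁ h₂
  · refine (hcof.and_eventually
      (hf.eventually_lt_of_isEventualUpperBound hθ hh hβ)).mono fun n ⟨hn, hlt⟩ ↦ ?_
    obtain ⟨x, hx, hfx⟩ := hTcof (h n) _ hlt
    have hxS : x ∈ S n := mem_insert_of_mem _ (by rwa [if_pos hn])
    exact (min_le_left _ _).trans_lt ((projUp_le hxS hfx).trans_lt (hT _ hx))

/-- If `h n` has the same uncountable regular cofinality `μ < cof θ` for infinitely many `n`, then some
level `x < μ` of fundamental sequences of these `h n` bounds cofinally many, hence all, `f α`. -/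
theorem exists_smaller_bound_of_cof_eq {ε θ : Ordinal.{u}} {f : Ordinal.{u} → ℕ → Ordinal.{u}}
    (hf : IsStronglyIncreasing ε θ f) (hθ : IsSuccLimit θ) {μ : Cardinal.{u}} (hμ : μ.IsRegular)
    (hμ₀ : ℵ₀ < μ) (hμθ : μ < θ.cof) {h : ℕ → Ordinal.{u}} (hh : IsEventualUpperBound θ f h)
    (hcof : ∃ᶠ n in atTop, (h n).cof = μ) :
    ∃ h', IsEventualUpperBound θ f h' ∧ (∀ n, h' n ≤ h n) ∧ ∃ᶠ n in atTop, h' n < h n := by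
  classical
  have he (n : ℕ) (hn : (h n).cof = μ) : ∃ e : Iio μ.ord → Iio (h n),
      Ordinal.IsFundamentalSeq e := Ordinal.exists_isFundamentalSeq (by rw [hn])
  choose e he using he
  -- `i α n` is a level of the fundamental sequence of `h n` that bounds `f α n`; since `μ` is
  -- uncountable and regular, the supremum of `i α n` over `n` stays below `μ`.
  have hstep (α : Ordinal.{u}) (n : ℕ) : ∃ i < μ.ord, ∀ hn : (h n).cof = μ, f α n < h n →
      ∃ hi : i < μ.ord, f α n ≤ e n hn ⟨i, hi⟩ := by
    by_cases hn : (h n).cof = μ ∧ f α n < h n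
    · obtain ⟨_, ⟨i, rfl⟩, hi⟩ := (he n hn.1).isCofinal_range ⟨_, hn.2⟩
      exact ⟨i, i.2, fun _ _ ↦ ⟨i.2, hi⟩⟩
    · exact ⟨0, (isSuccLimit_ord hμ.aleph0_le).bot_lt, fun h₁ h₂ ↦ (hn ⟨h₁, h₂⟩).elim⟩
  choose i hi hie using hstep
  have hsup (α : Ordinal.{u}) : ⨆ n, i α n < μ.ord :=
    Ordinal.lift_iSup_lt_of_lt_cof (by simpa [← Ordinal.lift_cof, hμ.cof_ord] using hμ₀) (hi α)
  have hstar : ∃ x : μ.ord.ToType, ∀ α < θ, ∃ α' < θ, α ≤ α' ∧ ⨆ n, i α' n = x.toOrd := by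
    by_contra! hbad
    choose a ha ha' using hbad
    have hs : ⨆ x, a x < θ := Ordinal.iSup_lt_of_lt_cof (by simpa using hμθ) ha
    exact ha' (Ordinal.ToType.mk ⟨_, hsup (⨆ x, a x)⟩) _ hs (Ordinal.le_iSup a _) (by simp)
  obtain ⟨x, hx⟩ := hstar
  refine ⟨fun n ↦ if hn : (h n).cof = μ then e n hn x.toOrd else h n, fun α hα ↦ ?_,
    fun n ↦ ?_, hcof.mono fun n hn ↦ ?_⟩
  · obtain ⟨α', hα', hαα', hix⟩ := hx α hα
    filter_upwards [hf.eventually_le hαα' hα', hh α hα,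
      hf.eventually_lt_of_isEventualUpperBound hθ hh hα'] with n h₁ h₂ h₃
    split_ifs with hn
    · obtain ⟨hi', hle⟩ := hie α' n hn h₃
      refine h₁.trans (hle.trans ((he n hn).strictMono.monotone ?_))
      exact (Ordinal.le_iSup (i α') n).trans_eq hix
    · exact h₂
  · dsimp only
    split_ifs with hn
    · exact (e n hn x.toOrd).2.le
    · rfl
  · simp only [dif_pos hn]
    exact (e n hn x.toOrd).2

/-- No upper bound that is at most `ε` is minimal modulo finite sets. -/
theorem exists_smaller_bound {κ : Cardinal.{u}} (hκ : κ.IsRegular) (hunc : ℵ₀ < κ)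
    {ε : Ordinal.{u}} (hε : ε < (succ (succ (succ κ))).ord) {f : Ordinal.{u} → ℕ → Ordinal.{u}}
    (hf : IsStronglyIncreasing ε (succ (succ (succ κ))).ord f) {h : ℕ → Ordinal.{u}}
    (hh : IsEventualUpperBound (succ (succ (succ κ))).ord f h) (hhε : ∀ n, h n ≤ ε) :
    ∃ h', IsEventualUpperBound (succ (succ (succ κ))).ord f h' ∧ (∀ n, h' n ≤ h n) ∧
      ∃ᶠ n in atTop, h' n < h n := by
  by_cases hcof : ∃ᶠ n in atTop, (h n).cof < κ
  · exact exists_smaller_bound_of_cof_lt hκ hunc hf hh hcof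
  have hreg₁ : (succ κ).IsRegular := isRegular_succ hκ.aleph0_le
  have hreg₂ : (succ (succ κ)).IsRegular := isRegular_succ hreg₁.aleph0_le
  have hreg₃ : (succ (succ (succ κ))).IsRegular := isRegular_succ hreg₂.aleph0_le
  have hle (n : ℕ) : (h n).cof ≤ succ (succ κ) := by
    rw [← lt_succ_iff]
    exact (Ordinal.cof_le_card _).trans_lt (lt_ord.1 ((hhε n).trans_lt hε))
  have hcases : ∃ᶠ n in atTop,
      (h n).cof = κ ∨ (h n).cof = succ κ ∨ (h n).cof = succ (succ κ) := by
    refine Eventually.frequently ((not_frequently.1 hcof).mono fun n hn ↦ ?_)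
    obtain hn | hn := (not_lt.1 hn).eq_or_lt
    · exact .inl hn.symm
    obtain hn | hn := (succ_le_of_lt hn).eq_or_lt
    · exact .inr (.inl hn.symm)
    · exact .inr (.inr ((hle n).antisymm (succ_le_of_lt hn)))
  have key (μ : Cardinal.{u}) (hμ : μ.IsRegular) (hκμ : κ ≤ μ) (hμ₂ : μ ≤ succ (succ κ)) :=
    exists_smaller_bound_of_cof_eq hf (isSuccLimit_ord hreg₃.aleph0_le) hμ (hunc.trans_le hκμ)
      (by rw [hreg₃.cof_ord]; exact lt_succ_of_le hμ₂) hh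
  rw [frequently_or_distrib, frequently_or_distrib] at hcases
  obtain hμ | hμ | hμ := hcases
  · exact key _ hκ le_rfl ((le_succ _).trans (le_succ _)) hμ
  · exact key _ hreg₁ (le_succ _) (le_succ _) hμ
  · exact key _ hreg₂ ((le_succ _).trans (le_succ _)) le_rfl hμ

/-! ### Strongly increasing sequences -/

theorem mainTheorem2 (lam : Cardinal.{u}) (hreg : lam.IsRegular)
    (hunc : Cardinal.aleph0.{u} < lam) (ε : Ordinal.{u})
    (hε : ε < (Order.succ (Order.succ (Order.succ lam))).ord) :
    ¬ ∃ f : Ordinal.{u} → ℕ → Ordinal.{u},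
      IsStronglyIncreasing ε (Order.succ (Order.succ (Order.succ lam))).ord f := by
  rintro ⟨f, hf⟩
  have hreg₃ : (succ (succ (succ lam))).IsRegular :=
    isRegular_succ (hreg.aleph0_le.trans ((lt_succ _).trans (lt_succ _)).le)
  have hℵ₁ : ℵ₁ ≤ lam := by rwa [aleph_one_le_iff]
  set θ := (succ (succ (succ lam))).ord with hθ
  have hℵ₁θ : ℵ₁ < θ.cof := by
    rw [hθ, hreg₃.cof_ord]
    exact hℵ₁.trans_lt ((lt_succ _).trans ((lt_succ _).trans (lt_succ _)))
  let X := {h : ℕ → Ordinal.{u} // IsEventualUpperBound θ f h ∧ ∀ n, h n ≤ ε}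
  have : Inhabited X :=
    ⟨fun _ ↦ ε, fun α hα ↦ .of_forall fun n ↦ (hf.lt_bound α hα n).le, fun _ ↦ le_rfl⟩
  let J := (ℵ₁ : Cardinal.{u}).ord.ToType
  have hJcof : cof J = ℵ₁ := by rw [Ordinal.cof_toType, isRegular_aleph_one.cof_ord]
  have : Nonempty J := by
    rw [← cof_ne_zero_iff, hJcof]; exact isRegular_aleph_one.pos.ne'
  have : NoMaxOrder J := by
    rw [← noTopOrder_iff_noMaxOrder, ← one_lt_cof_iff, hJcof]
    exact one_lt_aleph0.trans_le isRegular_aleph_one.aleph0_le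
  -- `S j g n` collects the values at `n` of the upper bounds constructed before stage `j`.
  let S (j : J) (g : J → X) (n : ℕ) : Set Ordinal.{u} := insert ε {s | ∃ k < j, (g k).1 n = s}
  have hεS (j : J) (g : J → X) (n : ℕ) : ε ∈ S j g n := mem_insert _ _
  have hex {α : Ordinal.{u}} (hα : α < θ) (j : J) (g : J → X) (n : ℕ) : ∃ s ∈ S j g n, f α n ≤ s :=
    ⟨ε, hεS j g n, (hf.lt_bound α hα n).le⟩
  obtain ⟨h, hh⟩ := exists_wellFounded_recursion (J := J) (X := X)
    (fun j g x ↦ ∃ β < θ, IsEventualUpperBound θ f (projUp (S j g) (f β)) ∧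
      ∃ᶠ n in atTop, x.1 n < projUp (S j g) (f β) n) (by
    intro j g
    have hS (n : ℕ) : #(S j g n) < Cardinal.lift.{u + 1} lam := by
      have hj : (Iio j).Countable := by
        rw [← le_aleph0_iff_set_countable, ← lt_succ_iff, succ_aleph0]
        exact (mk_Iio_lt j (by simp [J])).trans_eq (mk_ord_toType _)
      have : (S j g n).Countable := (hj.image fun k ↦ (g k).1 n).insert ε
      exact (le_aleph0_iff_set_countable.2 this).trans_lt (by simpa using hunc)
    obtain ⟨β, hβ, hβf⟩ := bounding_projection hreg hunc hf hS (hεS j g)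
    have hpε (n : ℕ) : projUp (S j g) (f β) n ≤ ε :=
      projUp_le (hεS j g n) (hf.lt_bound β hβ n).le
    obtain ⟨x, hx, hxp, hxlt⟩ := exists_smaller_bound hreg hunc hε hf hβf hpε
    exact ⟨⟨x, hx, fun n ↦ (hxp n).trans (hpε n)⟩, β, hβ, hβf, hxlt⟩) (by
    intro j g g' x hgg' hx
    have : S j g = S j g' := by
      funext n
      have (s : Ordinal.{u}) : (∃ k < j, (g k).1 n = s) ↔ ∃ k < j, (g' k).1 n = s :=
        exists_congr fun k ↦ and_congr_right fun hk ↦ by rw [hgg' k hk]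
      simp only [S, this]
    rwa [this] at hx)
  choose β hβ hβf hβlt using hh
  have hξ : ⨆ j, β j < θ := Ordinal.iSup_lt_of_lt_cof (by rwa [mk_ord_toType]) hβ
  have hanti (n : ULift.{u} ℕ) :
      Antitone fun j ↦ projUp (S j h) (f (⨆ j, β j)) n.down := fun j k hjk ↦
    projUp_mono (insert_subset_insert fun s ⟨l, hl, hs⟩ ↦ ⟨l, hl.trans_le hjk, hs⟩) le_rfl
      (hex hξ _ _ _)
  obtain ⟨j, hj⟩ := exists_forall_ge_eq_of_antitone_family (by
    rw [hJcof, mk_uLift, mk_nat, lift_aleph0]; exact aleph0_lt_aleph_one) hanti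
  obtain ⟨k, hjk⟩ := exists_gt j
  obtain ⟨n, ⟨hn₁, hn₂⟩, hn₃⟩ := (((hβlt j).and_eventually
    (hf.eventually_le (Ordinal.le_iSup β j) hξ)).and_eventually ((h j).2.1 _ hξ)).exists
  -- At `n`, the projection of `f ξ` for `ξ = sup β` strictly decreases from stage `j` to stage `k`:
  -- stage `k` admits the value `h j n`, which lies below the projection at stage `j`.
  have h₁ : projUp (S k h) (f (⨆ j, β j)) n ≤ (h j).1 n :=
    projUp_le (mem_insert_of_mem _ ⟨j, hjk, rfl⟩) hn₃
  have h₂ : projUp (S j h) (f (β j)) n ≤ projUp (S j h) (f (⨆ j, β j)) n :=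
    projUp_mono Subset.rfl hn₂ (hex hξ _ _ _)
  exact ((h₁.trans_lt hn₁).trans_le h₂).ne (hj ⟨n⟩ k hjk.le)
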